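/- Let $\mathbb{K}$ be a field of characteristic zero, let $\ell\ge 2$, $V=\mathbb{K}^\ell$ and $S=\mathbb{K}[x_1,\ldots,x_\ell]$. Let $\mathcal{A}$ be an essential hyperplane arrangement in $V$, i.e. a finite set of linear hyperplanes with $\bigcap_{H\in\mathcal{A}}H=\{0\}$. For an arrangement $\mathcal{B}$ in $V$ (not necessarily essential) choose linear forms $\alpha_L$ with $\ker\alpha_L=L$ for $L\in\mathcal{B}$, put $Q(\mathcal{B})=\prod_{L\in\mathcal{B}}\alpha_L$, and let $$D(\mathcal{B})=\{\theta\in\operatorname{Der}_{\mathbb K}S \mid \theta(\alpha_L)\in S\alpha_L\ \ \forall L\in\mathcal{B}\},\qquad D_0(\mathcal{B})=\{\theta\in D(\mathcal{B})\mid \theta(Q(\mathcal{B}))=0\}.$$ These are graded $S$-modules, where a derivation $\theta\neq0$ is homogeneous of degree $e$ if $\theta(g)$ is zero or homogeneous of degree $e$ for every linear form $g$. Let $r(\mathcal{B})=\min\{r\mid D_0(\mathcal{B})_r\neq 0\}$. Suppose that $\mathcal{A}$ is free with exponents $(1,d_2,\ldots,d_\ell)$, $1\le d_2\le\cdots\le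 d_\ell$; that is, $D(\mathcal{A})$ is a free $S$-module and has a minimal set of generators $\theta_1,\ldots,\theta_\ell$, homogeneous of degrees $1,d_2,\ldots,d_\ell$, with $\theta_1=\sum_i x_i\partial_{x_i}$ the Euler derivation. Let $H\in\mathcal{A}$, $\mathcal{A}'=\mathcal{A}\setminus\{H\}$ and $\mathcal{A}^H=\{H\cap L\mid L\in\mathcal{A}'\}$. Then $r(\mathcal{A}')=d_2-1$ if and only if $|\mathcal{A}|-|\mathcal{A}^H|=d_2$. Otherwise, i.e. if $|\mathcal{A}|-|\mathcal{A}^H|\neq d_2$, one has $r(\mathcal{A}')=d_2$. -/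

import Mathlib

open MvPolynomial

/-- A hyperplane arrangement in `V = K^ℓ`: a finite set of linear hyperplanes of `V`
(the hyperplanes are the maximal proper subspaces). -/
structure HyperplaneArrangement (K : Type*) [Field K] (ℓ : ℕ) where
  hyperplanes : Finset (Submodule K (Fin ℓ → K))
  isCoatom' : ∀ H ∈ hyperplanes, IsCoatom H

namespace HyperplaneArrangement

variable {K : Type*} [Field K] {ℓ : ℕ}

theorem exists_ker_eq {H : Submodule K (Fin ℓ → K)} (hH : IsCoatom H) :
    ∃ α : Module.Dual K (Fin ℓ → K), LinearMap.ker α = H := by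
  obtain ⟨v, hv⟩ : ∃ v, v ∉ H := by
    by_contra! h
    exact hH.1 (eq_top_iff.2 fun x _ => h x)
  obtain ⟨α, hα, hle⟩ := Submodule.exists_le_ker_of_notMem hv
  refine ⟨α, (hH.le_iff.1 hle).resolve_left fun h => hα ?_⟩
  have : v ∈ LinearMap.ker α := h ▸ Submodule.mem_top
  simpa using this

/-- A linear form `α_H ∈ V*` with kernel `H`, fixed for each hyperplane `H`. -/
noncomputable def linearForm (H : Submodule K (Fin ℓ → K)) : Module.Dual K (Fin ℓ → K) :=
  Classical.epsilon fun α => LinearMap.ker α = H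

theorem ker_linearForm {H : Submodule K (Fin ℓ → K)} (hH : IsCoatom H) :
    LinearMap.ker (linearForm H) = H :=
  Classical.epsilon_spec (exists_ker_eq hH)

/-- A linear form `α` on `K^ℓ`, viewed as the polynomial `∑ i, α(e_i) x_i` of degree one in
`S = K[x_1, …, x_ℓ]`. -/
noncomputable def toPoly (α : Module.Dual K (Fin ℓ → K)) : MvPolynomial (Fin ℓ) K :=
  ∑ i, C (α (Pi.single i 1)) * X i

/-- The module `Der S` of `K`-derivations of `S = K[x_1, …, x_ℓ]`. -/
abbrev Der (K : Type*) [Field K] (ℓ : ℕ) : Type _ :=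
  Derivation K (MvPolynomial (Fin ℓ) K) (MvPolynomial (Fin ℓ) K)

/-- The derivation `θ` is zero or homogeneous of degree `e`: `θ g` is zero or homogeneous of
degree `e` for all `g ∈ S_1`. (In Mathlib, `0` is homogeneous of every degree.) -/
def IsHomogeneousDer (θ : Der K ℓ) (e : ℕ) : Prop :=
  ∀ g : MvPolynomial (Fin ℓ) K, g.IsHomogeneous 1 → (θ g).IsHomogeneous e

/-- The Euler derivation `∑ i, x_i ∂_{x_i}`. -/
noncomputable def euler (K : Type*) [Field K] (ℓ : ℕ) : Der K ℓ :=
  ∑ i, (X i : MvPolynomial (Fin ℓ) K) • pderiv i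

/-- `A` is essential if its hyperplanes meet only in the origin. -/
def IsEssential (A : HyperplaneArrangement K ℓ) : Prop :=
  ⨅ H ∈ A.hyperplanes, H = ⊥

open Classical in
/-- The deletion `A ∖ {H}`. -/
noncomputable def deletion (A : HyperplaneArrangement K ℓ) (H : Submodule K (Fin ℓ → K)) :
    HyperplaneArrangement K ℓ where
  hyperplanes := A.hyperplanes.erase H
  isCoatom' L hL := A.isCoatom' L (Finset.mem_of_mem_erase hL)

open Classical in
/-- The restriction `A^H = {H ∩ L | L ∈ A ∖ {H}}`, as a finite set of subspaces of `V`. -/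
noncomputable def restriction (A : HyperplaneArrangement K ℓ) (H : Submodule K (Fin ℓ → K)) :
    Finset (Submodule K (Fin ℓ → K)) :=
  (A.hyperplanes.erase H).image fun L => H ⊓ L

/-- The defining polynomial `Q(A) = ∏_{H ∈ A} α_H`. -/
noncomputable def definingPoly (A : HyperplaneArrangement K ℓ) : MvPolynomial (Fin ℓ) K :=
  ∏ H ∈ A.hyperplanes, toPoly (linearForm H)

/-- The logarithmic derivation module
`D(A) = {θ ∈ Der S | θ(α_H) ∈ S α_H for all H ∈ A}`. -/
noncomputable def logDer (A : HyperplaneArrangement K ℓ) :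
    Submodule (MvPolynomial (Fin ℓ) K) (Der K ℓ) where
  carrier := {θ | ∀ H ∈ A.hyperplanes,
    θ (toPoly (linearForm H)) ∈ Ideal.span {toPoly (linearForm H)}}
  zero_mem' := fun H _ => by simp
  add_mem' := fun ha hb H hH => by
    simpa using Ideal.add_mem _ (ha H hH) (hb H hH)
  smul_mem' := fun c θ hθ H hH => by
    simpa using Ideal.mul_mem_left _ c (hθ H hH)

/-- `D_0(A) = {θ ∈ D(A) | θ(Q(A)) = 0}`. -/
noncomputable def logDerZero (A : HyperplaneArrangement K ℓ) :
    Submodule (MvPolynomial (Fin ℓ) K) (Der K ℓ) where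
  carrier := {θ | θ ∈ A.logDer ∧ θ A.definingPoly = 0}
  zero_mem' := ⟨A.logDer.zero_mem, by simp⟩
  add_mem' := fun ha hb => ⟨A.logDer.add_mem ha.1 hb.1, by simp [ha.2, hb.2]⟩
  smul_mem' := fun c θ hθ => ⟨A.logDer.smul_mem c hθ.1, by simp [hθ.2]⟩

/-- The minimal degree of a Jacobian relation, `r(A) = min {r | D_0(A)_r ≠ 0}`. All degrees are
nonnegative since they are degrees of polynomial coefficients; for `ℓ ≥ 2` and characteristic
zero the minimum is over a nonempty set, see `isLeast_mdr`. -/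
noncomputable def mdr (A : HyperplaneArrangement K ℓ) : ℕ :=
  sInf {r : ℕ | ∃ θ ∈ A.logDerZero, θ ≠ 0 ∧ IsHomogeneousDer θ r}

theorem toPoly_isHomogeneous (α : Module.Dual K (Fin ℓ → K)) : (toPoly α).IsHomogeneous 1 :=
  IsHomogeneous.sum _ _ _ fun i _ => by
    simpa using (isHomogeneous_C (Fin ℓ) (α (Pi.single i 1))).mul (isHomogeneous_X K i)

theorem toPoly_ne_zero {α : Module.Dual K (Fin ℓ → K)} (hα : α ≠ 0) : toPoly α ≠ 0 := by
  intro h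
  apply hα
  refine LinearMap.pi_ext' fun i => LinearMap.ext_ring ?_
  have h1 := congrArg (MvPolynomial.eval (Pi.single i (1 : K))) h
  simpa [toPoly, Pi.single_apply] using h1

theorem linearForm_ne_zero {H : Submodule K (Fin ℓ → K)} (hH : IsCoatom H) :
    linearForm H ≠ 0 := by
  intro h
  have h1 := ker_linearForm hH
  rw [h, LinearMap.ker_zero] at h1
  exact hH.1 h1.symm

theorem definingPoly_ne_zero (A : HyperplaneArrangement K ℓ) : A.definingPoly ≠ 0 :=
  Finset.prod_ne_zero_iff.2 fun H hH => toPoly_ne_zero (linearForm_ne_zero (A.isCoatom' H hH))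

theorem definingPoly_isHomogeneous (A : HyperplaneArrangement K ℓ) :
    A.definingPoly.IsHomogeneous A.hyperplanes.card := by
  simpa [definingPoly] using IsHomogeneous.prod A.hyperplanes (fun H => toPoly (linearForm H)) (fun _ => 1)
    fun H _ => toPoly_isHomogeneous _

theorem definingPoly_smul_mem (A : HyperplaneArrangement K ℓ) (θ : Der K ℓ) :
    A.definingPoly • θ ∈ A.logDer := fun H hH => by
  simpa [definingPoly] using Ideal.mul_mem_right _ _
    (Ideal.mem_span_singleton.2 (Finset.dvd_prod_of_mem (fun H => toPoly (linearForm H)) hH))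

/-- For `ℓ ≥ 2` the minimum defining `r(A)` is attained. -/
theorem isLeast_mdr (hℓ : 2 ≤ ℓ) (A : HyperplaneArrangement K ℓ) :
    IsLeast {r : ℕ | ∃ θ ∈ A.logDerZero, θ ≠ 0 ∧ IsHomogeneousDer θ r} A.mdr := by
  suffices hne : {r : ℕ | ∃ θ ∈ A.logDerZero, θ ≠ 0 ∧ IsHomogeneousDer θ r}.Nonempty from
    ⟨Nat.sInf_mem hne, fun _ hr => Nat.sInf_le hr⟩
  have hQ := A.definingPoly_ne_zero
  have hQh := A.definingPoly_isHomogeneous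
  let i : Fin ℓ := ⟨0, by omega⟩
  let j : Fin ℓ := ⟨1, by omega⟩
  have hij : i ≠ j := by simp [i, j]
  set Q := A.definingPoly with hQdef
  by_cases h : pderiv i Q = 0
  · refine ⟨A.hyperplanes.card, Q • pderiv i, ⟨A.definingPoly_smul_mem _, by simp [← hQdef, h]⟩,
      fun h0 => hQ ?_, fun g hg => ?_⟩
    · simpa using congrArg (fun θ : Der K ℓ => θ (X i)) h0
    · simpa using hQh.mul (hg.pderiv (i := i))
  · refine ⟨A.hyperplanes.card + (A.hyperplanes.card - 1),
      Q • (pderiv j Q • pderiv i - pderiv i Q • pderiv j),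
      ⟨A.definingPoly_smul_mem _, ?_⟩, fun h0 => ?_, fun g hg => ?_⟩
    · simp [← hQdef, mul_comm]
    · have := congrArg (fun θ : Der K ℓ => θ (X j)) h0
      simp [pderiv_X_of_ne hij.symm, hQ, h] at this
    · have h1 := hQh.mul (((hQh.pderiv (i := j)).mul (hg.pderiv (i := i))).sub
        ((hQh.pderiv (i := i)).mul (hg.pderiv (i := j))))
      simpa using h1

/-- `A` is free: the `S`-module `D(A)` is free. -/
def IsFree (A : HyperplaneArrangement K ℓ) : Prop :=
  Module.Free (MvPolynomial (Fin ℓ) K) A.logDer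

/-- `exp(A) = (d_1, …, d_k)`: there are homogeneous derivations `θ_1 = θ_E, θ_2, …, θ_k` with
`deg θ_j = d_j` which form a minimal set of generators of `D(A)`. -/
def HasExponents (A : HyperplaneArrangement K ℓ) {k : ℕ} (d : Fin k → ℕ) : Prop :=
  ∃ θ : Fin k → Der K ℓ,
    (∀ j : Fin k, (j : ℕ) = 0 → θ j = euler K ℓ) ∧
    (∀ j, IsHomogeneousDer (θ j) (d j)) ∧
    Submodule.span (MvPolynomial (Fin ℓ) K) (Set.range θ) = A.logDer ∧
    (∀ j, θ j ∉ Submodule.span (MvPolynomial (Fin ℓ) K) (θ '' {i | i ≠ j}))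

end HyperplaneArrangement

/-! Write `α` for the linear form of `H`, `Q'` for the defining polynomial of the deletion `A'`, and
`e = |A'| - |A^H|`. The claim is that `r(A')` is `d_2 - 1` when `e = d_2 - 1`, and `d_2` otherwise.

Two bounds come from the exponents. If `η ≠ 0` lies in `D_0(A')`, then `α • η` lies in `D(A)`. It is
not a multiple of the Euler derivation, because `η` kills `Q'` while Euler multiplies it by `|A'| ≠
0`. Below degree `d_2` only such multiples exist in `D(A)`, so `r(A') ≥ d_2 - 1`. Conversely `θ_2`,
corrected by a multiple of Euler, lies in `D_0(A')`, so `r(A') ≤ d_2`.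

The number `e` decides between the two values. Any homogeneous member of `D(A')` outside `D(A)` has
degree at least `e` (`card_deletion_le_add`), and freeness produces one of degree exactly `e`
(`exists_deletion_logDer`). The latter gives `d_2 - 1 ≤ e` and `r(A') ≤ e`. If `r(A') < d_2`, a
minimal element of `D_0(A')` cannot lie in `D(A)`, hence `e ≤ r(A')`.

The derivation of degree `e` comes from Saito's criterion (`exists_det_eq_C_mul`): restricted to
`H`, the minors of the coefficient matrix are divisible by the defining polynomial of `A^H`, and
dividing by it lowers the degree to `e`. -/

namespace HyperplaneArrangement

variable {K : Type*} [Field K] {ℓ : ℕ}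

/-! ### Homogeneous components and divisibility. -/

section Components

variable {σ R : Type*} [CommSemiring R]

theorem homogeneousComponent_add_mul {f g : MvPolynomial σ R} {d : ℕ} (hg : g.IsHomogeneous d)
    (k : ℕ) : homogeneousComponent (k + d) (f * g) = homogeneousComponent k f * g := by
  classical
  conv_lhs => rw [← sum_homogeneousComponent f, Finset.sum_mul, map_sum]
  have h : ∀ i, homogeneousComponent (k + d) (homogeneousComponent i f * g) =
      if k = i then homogeneousComponent i f * g else 0 := fun i => by
    rw [homogeneousComponent_of_mem ((homogeneousComponent_isHomogeneous i f).mul hg)]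
    simp
  simp only [h, Finset.sum_ite_eq, Finset.mem_range]
  split_ifs with hk
  · rfl
  · rw [homogeneousComponent_eq_zero _ _ (by omega), zero_mul]

theorem homogeneousComponent_mul_eq_zero {f g : MvPolynomial σ R} {d n : ℕ}
    (hg : g.IsHomogeneous d) (hn : n < d) : homogeneousComponent n (f * g) = 0 := by
  classical
  rw [← sum_homogeneousComponent f, Finset.sum_mul, map_sum]
  refine Finset.sum_eq_zero fun i _ => ?_
  rw [homogeneousComponent_of_mem ((homogeneousComponent_isHomogeneous i f).mul hg),
    if_neg (by omega)]

theorem dvd_homogeneousComponent {f g : MvPolynomial σ R} {d : ℕ} (hg : g.IsHomogeneous d)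
    (h : g ∣ f) (n : ℕ) : g ∣ homogeneousComponent n f := by
  obtain ⟨q, rfl⟩ := h
  rw [mul_comm]
  rcases lt_or_ge n d with hn | hn
  · simp [homogeneousComponent_mul_eq_zero hg hn]
  · obtain ⟨k, rfl⟩ := Nat.exists_eq_add_of_le' hn
    exact ⟨_, (homogeneousComponent_add_mul hg k).trans (mul_comm _ _)⟩

end Components

/-! ### Linear forms and reduction modulo one of them. -/

section LinearForms

theorem toPoly_smul (c : K) (a : Module.Dual K (Fin ℓ → K)) :
    toPoly (c • a) = C c * toPoly a := by
  simp [toPoly, Finset.mul_sum, mul_assoc]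

theorem toPoly_sub (a b : Module.Dual K (Fin ℓ → K)) : toPoly (a - b) = toPoly a - toPoly b := by
  simp [toPoly, sub_mul, Finset.sum_sub_distrib]

theorem exists_apply_single_ne_zero {a : Module.Dual K (Fin ℓ → K)} (ha : a ≠ 0) :
    ∃ p, a (Pi.single p 1) ≠ 0 := by
  by_contra! h
  exact ha (LinearMap.pi_ext' fun i => LinearMap.ext_ring (by simpa using h i))

/-- The linear form `b` with a multiple of `a` subtracted so as to vanish on the `p`-th standard
basis vector. -/
noncomputable def reduceForm (a : Module.Dual K (Fin ℓ → K)) (p : Fin ℓ)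
    (b : Module.Dual K (Fin ℓ → K)) : Module.Dual K (Fin ℓ → K) :=
  b - (b (Pi.single p 1) / a (Pi.single p 1)) • a

theorem toPoly_reduceForm (a : Module.Dual K (Fin ℓ → K)) (p : Fin ℓ)
    (b : Module.Dual K (Fin ℓ → K)) : toPoly (reduceForm a p b) =
      toPoly b - C (b (Pi.single p 1) / a (Pi.single p 1)) * toPoly a := by
  rw [reduceForm, toPoly_sub, toPoly_smul]

theorem reduceForm_apply_single {a : Module.Dual K (Fin ℓ → K)} {p : Fin ℓ}
    (hp : a (Pi.single p 1) ≠ 0) (b : Module.Dual K (Fin ℓ → K)) :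
    reduceForm a p b (Pi.single p 1) = 0 := by
  simp [reduceForm, hp]

/-- The substitution that eliminates the variable `x_p` by means of `a = 0`. -/
noncomputable def reduce (a : Module.Dual K (Fin ℓ → K)) (p : Fin ℓ) :
    MvPolynomial (Fin ℓ) K →ₐ[K] MvPolynomial (Fin ℓ) K :=
  aeval fun j => X j - C ((Pi.single j 1 : Fin ℓ → K) p / a (Pi.single p 1)) * toPoly a

theorem reduce_toPoly (a : Module.Dual K (Fin ℓ → K)) (p : Fin ℓ)
    (b : Module.Dual K (Fin ℓ → K)) :
    reduce a p (toPoly b) = toPoly (reduceForm a p b) := by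
  rw [toPoly_reduceForm]
  conv_lhs => rw [toPoly]
  simp only [map_sum, map_mul, reduce, aeval_X, algHom_C, algebraMap_eq, mul_sub,
    Finset.sum_sub_distrib]
  congr 1
  rw [Finset.sum_eq_single p]
  · rw [← mul_assoc, ← C_mul]; simp [div_eq_mul_inv]
  · intro j _ hj
    simp [hj.symm]
  · simp

theorem reduce_self {a : Module.Dual K (Fin ℓ → K)} {p : Fin ℓ} (hp : a (Pi.single p 1) ≠ 0) :
    reduce a p (toPoly a) = 0 := by
  rw [reduce_toPoly, toPoly_reduceForm, div_self hp]; simp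

theorem dvd_sub_reduce (a : Module.Dual K (Fin ℓ → K)) (p : Fin ℓ)
    (f : MvPolynomial (Fin ℓ) K) : toPoly a ∣ f - reduce a p f := by
  rw [← Ideal.mem_span_singleton, ← Ideal.Quotient.mk_eq_mk_iff_sub_mem]
  have : Ideal.Quotient.mkₐ K (Ideal.span {toPoly a}) =
      (Ideal.Quotient.mkₐ K (Ideal.span {toPoly a})).comp (reduce a p) := by
    refine algHom_ext fun j => ?_
    simp only [AlgHom.comp_apply, Ideal.Quotient.mkₐ_eq_mk]
    rw [Ideal.Quotient.mk_eq_mk_iff_sub_mem, Ideal.mem_span_singleton]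
    simp [reduce]
  exact DFunLike.congr_fun this f

/-- The substitution moves only `x_p`, and does so by a multiple of `a`; its kernel is therefore the
ideal of `a`. Divisibility by `a` becomes vanishing in a domain, whence primality of `a`. -/
theorem dvd_iff_reduce_eq_zero {a : Module.Dual K (Fin ℓ → K)} {p : Fin ℓ}
    (hp : a (Pi.single p 1) ≠ 0) {f : MvPolynomial (Fin ℓ) K} :
    toPoly a ∣ f ↔ reduce a p f = 0 := by
  constructor
  · rintro ⟨g, rfl⟩
    rw [map_mul, reduce_self hp, zero_mul]
  · intro h
    simpa [h] using dvd_sub_reduce a p f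

theorem reduce_isHomogeneous (a : Module.Dual K (Fin ℓ → K)) (p : Fin ℓ)
    {f : MvPolynomial (Fin ℓ) K} {n : ℕ} (hf : f.IsHomogeneous n) :
    (reduce a p f).IsHomogeneous n := by
  have := hf.aeval (fun j => X j - C ((Pi.single j 1 : Fin ℓ → K) p / a (Pi.single p 1)) *
    toPoly a) (n := 1) fun j => (isHomogeneous_X K j).sub ((toPoly_isHomogeneous a).C_mul _)
  simpa [reduce] using this

theorem prime_toPoly {a : Module.Dual K (Fin ℓ → K)} (ha : a ≠ 0) : Prime (toPoly a) := by
  obtain ⟨p, hp⟩ := exists_apply_single_ne_zero ha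
  refine ⟨toPoly_ne_zero ha, fun hu => ?_, fun f g h => ?_⟩
  · have := (dvd_iff_reduce_eq_zero hp).1 (isUnit_iff_dvd_one.1 hu)
    simp at this
  · simp only [dvd_iff_reduce_eq_zero hp, map_mul, mul_eq_zero] at h ⊢
    exact h

theorem toPoly_dvd_toPoly {a b : Module.Dual K (Fin ℓ → K)} (ha : a ≠ 0)
    (h : toPoly a ∣ toPoly b) : ∃ c : K, b = c • a := by
  obtain ⟨p, hp⟩ := exists_apply_single_ne_zero ha
  rw [dvd_iff_reduce_eq_zero hp, reduce_toPoly] at h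
  refine ⟨_, sub_eq_zero.1 (by_contra fun h0 => toPoly_ne_zero h0 h)⟩

theorem isRelPrime_toPoly {a b : Module.Dual K (Fin ℓ → K)} (ha : a ≠ 0)
    (h : ∀ c : K, b ≠ c • a) : IsRelPrime (toPoly a) (toPoly b) :=
  (prime_toPoly ha).irreducible.isRelPrime_iff_not_dvd.2 fun hd =>
    let ⟨c, hc⟩ := toPoly_dvd_toPoly ha hd
    h c hc

theorem linearForm_ne_smul {L L' : Submodule K (Fin ℓ → K)} (hL : IsCoatom L)
    (hL' : IsCoatom L') (hne : L ≠ L') (c : K) : linearForm L' ≠ c • linearForm L := by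
  intro h
  have hc : c ≠ 0 := by
    rintro rfl
    exact linearForm_ne_zero hL' (by simpa using h)
  apply hne
  rw [← ker_linearForm hL, ← ker_linearForm hL', h, LinearMap.ker_smul _ _ hc]

theorem isRelPrime_linearForm {L L' : Submodule K (Fin ℓ → K)} (hL : IsCoatom L)
    (hL' : IsCoatom L') (hne : L ≠ L') :
    IsRelPrime (toPoly (linearForm L)) (toPoly (linearForm L')) :=
  isRelPrime_toPoly (linearForm_ne_zero hL) (linearForm_ne_smul hL hL' hne)

theorem not_toPoly_linearForm_dvd {L L' : Submodule K (Fin ℓ → K)} (hL : IsCoatom L)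
    (hL' : IsCoatom L') (hne : L ≠ L') :
    ¬ toPoly (linearForm L) ∣ toPoly (linearForm L') := fun hd =>
  let ⟨c, hc⟩ := toPoly_dvd_toPoly (linearForm_ne_zero hL) hd
  linearForm_ne_smul hL hL' hne c hc

/-- The reduced form is `b` composed with the projection onto `ker a` along the `p`-th standard
basis vector. -/
theorem reduceForm_apply {a : Module.Dual K (Fin ℓ → K)} {p : Fin ℓ}
    (b : Module.Dual K (Fin ℓ → K)) (v : Fin ℓ → K) :
    reduceForm a p b v = b (v - (a v / a (Pi.single p 1)) • Pi.single p 1) := by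
  simp [reduceForm]; ring

theorem ker_inf_ker_reduceForm (a : Module.Dual K (Fin ℓ → K)) (p : Fin ℓ)
    (b : Module.Dual K (Fin ℓ → K)) :
    LinearMap.ker a ⊓ LinearMap.ker (reduceForm a p b) = LinearMap.ker a ⊓ LinearMap.ker b := by
  ext v
  simp only [Submodule.mem_inf, LinearMap.mem_ker]
  exact and_congr_right fun hv => by simp [reduceForm, hv]

/-- A reduced form factors through the projection onto `ker a` along the `p`-th basis vector, so it
is determined by its restriction to `ker a`; there, inclusion of kernels forces proportionality. -/
theorem exists_reduceForm_eq_smul {a b b' : Module.Dual K (Fin ℓ → K)} {p : Fin ℓ}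
    (hp : a (Pi.single p 1) ≠ 0)
    (h : LinearMap.ker a ⊓ LinearMap.ker b ≤ LinearMap.ker a ⊓ LinearMap.ker b') :
    ∃ c : K, reduceForm a p b' = c • reduceForm a p b := by
  have hmem : reduceForm a p b' ∈ Submodule.span K (Set.range fun _ : Unit => reduceForm a p b) := by
    refine mem_span_of_iInf_ker_le_ker fun v hv => ?_
    simp only [iInf_const, LinearMap.mem_ker, reduceForm_apply] at hv ⊢
    exact (h (x := v - (a v / a (Pi.single p 1)) • Pi.single p 1) ⟨by simp [hp], hv⟩).2
  obtain ⟨c, hc⟩ := Submodule.mem_span_singleton.1 (by simpa using hmem)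
  exact ⟨c, hc.symm⟩

theorem reduceForm_ne_zero {a b : Module.Dual K (Fin ℓ → K)} {p : Fin ℓ}
    (h : ∀ c : K, b ≠ c • a) : reduceForm a p b ≠ 0 := fun h0 =>
  h _ (sub_eq_zero.1 h0)

end LinearForms

/-! ### Graded pieces of derivations and the Euler derivation. -/

section Derivations

theorem der_toPoly (θ : Der K ℓ) (b : Module.Dual K (Fin ℓ → K)) :
    θ (toPoly b) = ∑ j, C (b (Pi.single j 1)) * θ (X j) := by
  simp [toPoly]

theorem isHomogeneousDer_iff {θ : Der K ℓ} {e : ℕ} :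
    IsHomogeneousDer θ e ↔ ∀ j, (θ (X j)).IsHomogeneous e := by
  refine ⟨fun h j => h _ (isHomogeneous_X K j), fun h g hg => ?_⟩
  rw [← mem_homogeneousSubmodule, homogeneousSubmodule_one_eq_span_X] at hg
  induction hg using Submodule.span_induction with
  | mem x hx => obtain ⟨j, rfl⟩ := hx; exact h j
  | zero => simpa using isHomogeneous_zero (Fin ℓ) K e
  | add x y _ _ hx hy => simpa using hx.add hy
  | smul c x _ hx =>
    rw [Derivation.map_smul, smul_eq_C_mul]
    exact hx.C_mul c

/-- The component of degree `e` of a derivation. -/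
noncomputable def homogeneousPart (θ : Der K ℓ) (e : ℕ) : Der K ℓ :=
  mkDerivation K fun j => homogeneousComponent e (θ (X j))

theorem homogeneousPart_toPoly (θ : Der K ℓ) (e : ℕ) (b : Module.Dual K (Fin ℓ → K)) :
    homogeneousPart θ e (toPoly b) = homogeneousComponent e (θ (toPoly b)) := by
  simp only [der_toPoly, map_sum, homogeneousPart, mkDerivation_X, homogeneousComponent_C_mul]

theorem isHomogeneousDer_homogeneousPart (θ : Der K ℓ) (e : ℕ) :
    IsHomogeneousDer (homogeneousPart θ e) e :=
  isHomogeneousDer_iff.2 fun j => by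
    simpa [homogeneousPart] using homogeneousComponent_isHomogeneous e (θ (X j))

theorem derivation_sum_apply {ι : Type*} (s : Finset ι) (θ : ι → Der K ℓ)
    (f : MvPolynomial (Fin ℓ) K) : (∑ i ∈ s, θ i) f = ∑ i ∈ s, θ i f := by
  exact map_sum ((Pi.evalAddMonoidHom _ f).comp Derivation.coeFnAddMonoidHom) θ s

theorem euler_X (j : Fin ℓ) : euler K ℓ (X j) = X j := by
  classical
  simp [euler, derivation_sum_apply, pderiv_X, Pi.single_apply]

theorem euler_toPoly (b : Module.Dual K (Fin ℓ → K)) : euler K ℓ (toPoly b) = toPoly b := by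
  rw [der_toPoly]
  simp [euler_X, toPoly]

theorem derivation_prod {ι : Type*} {θ : Der K ℓ} {s : Finset ι}
    {f h : ι → MvPolynomial (Fin ℓ) K} (hθ : ∀ i ∈ s, θ (f i) = f i * h i) :
    θ (∏ i ∈ s, f i) = (∏ i ∈ s, f i) * ∑ i ∈ s, h i := by
  classical
  induction s using Finset.induction_on with
  | empty => simp
  | insert i s hi ih =>
    rw [Finset.prod_insert hi, Finset.sum_insert hi, Derivation.leibniz,
      hθ i (Finset.mem_insert_self i s),
      ih fun j hj => hθ j (Finset.mem_insert_of_mem hj), smul_eq_mul, smul_eq_mul]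
    ring

/-- The quotient should have degree `e - 1`. Stating this through products with linear forms also
covers `e = 0`, where `b` vanishes and `q = 0` is chosen. -/
theorem exists_homogeneous_quotient {a b : MvPolynomial (Fin ℓ) K} {e : ℕ}
    (ha : a.IsHomogeneous 1) (hb : b.IsHomogeneous e) (h : a ∣ b) :
    ∃ q : MvPolynomial (Fin ℓ) K, b = a * q ∧
      ∀ g : MvPolynomial (Fin ℓ) K, g.IsHomogeneous 1 → (q * g).IsHomogeneous e := by
  obtain ⟨q, rfl⟩ := h
  rw [mul_comm] at hb ⊢
  rcases e with _ | k
  · refine ⟨0, ?_, fun g _ => by simpa using isHomogeneous_zero (Fin ℓ) K 0⟩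
    rw [← homogeneousComponent_eq_self hb, homogeneousComponent_mul_eq_zero ha one_pos, mul_zero]
  · refine ⟨homogeneousComponent k q, ?_, fun g hg =>
      (homogeneousComponent_isHomogeneous k q).mul hg⟩
    rw [mul_comm a, ← homogeneousComponent_add_mul ha, homogeneousComponent_eq_self hb]

end Derivations

/-! ### Gradedness of `D(A)` and the passage to `D_0(A)`. -/

section LogDer

variable {A : HyperplaneArrangement K ℓ}

theorem mem_logDer {θ : Der K ℓ} : θ ∈ A.logDer ↔
    ∀ L ∈ A.hyperplanes, toPoly (linearForm L) ∣ θ (toPoly (linearForm L)) :=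
  forall₂_congr fun _ _ => Ideal.mem_span_singleton

theorem homogeneousPart_mem_logDer {θ : Der K ℓ} (hθ : θ ∈ A.logDer) (e : ℕ) :
    homogeneousPart θ e ∈ A.logDer :=
  mem_logDer.2 fun L hL => by
    rw [homogeneousPart_toPoly]
    exact dvd_homogeneousComponent (toPoly_isHomogeneous _) (mem_logDer.1 hθ L hL) e

theorem euler_mem_logDer : euler K ℓ ∈ A.logDer :=
  mem_logDer.2 fun L _ => by rw [euler_toPoly]

theorem euler_definingPoly :
    euler K ℓ A.definingPoly = A.definingPoly * (A.hyperplanes.card : MvPolynomial (Fin ℓ) K) := by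
  rw [definingPoly, derivation_prod (h := fun _ => 1) fun L _ => by rw [euler_toPoly, mul_one]]
  simp

variable [CharZero K]

theorem eq_zero_of_smul_euler_definingPoly (hA : A.hyperplanes.Nonempty)
    {f : MvPolynomial (Fin ℓ) K} (h : f * euler K ℓ A.definingPoly = 0) : f = 0 := by
  rw [euler_definingPoly, mul_eq_zero, mul_eq_zero, Nat.cast_eq_zero] at h
  exact h.resolve_right (not_or.2 ⟨A.definingPoly_ne_zero, hA.card_ne_zero⟩)

/-- A homogeneous logarithmic derivation can be corrected by a multiple of the Euler derivation
so as to annihilate the defining polynomial. -/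
theorem exists_sub_smul_euler_mem_logDerZero (hA : A.hyperplanes.Nonempty) {θ : Der K ℓ}
    (hθ : θ ∈ A.logDer) {e : ℕ} (he : IsHomogeneousDer θ e) :
    ∃ f : MvPolynomial (Fin ℓ) K, θ - f • euler K ℓ ∈ A.logDerZero ∧
      IsHomogeneousDer (θ - f • euler K ℓ) e := by
  have key : ∀ L : Submodule K (Fin ℓ → K), ∃ q : MvPolynomial (Fin ℓ) K, L ∈ A.hyperplanes →
      θ (toPoly (linearForm L)) = toPoly (linearForm L) * q ∧
      ∀ g : MvPolynomial (Fin ℓ) K, g.IsHomogeneous 1 → (q * g).IsHomogeneous e := by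
    intro L
    by_cases hL : L ∈ A.hyperplanes
    · obtain ⟨q, hq⟩ := exists_homogeneous_quotient (toPoly_isHomogeneous (linearForm L))
        (he _ (toPoly_isHomogeneous (linearForm L))) (mem_logDer.1 hθ L hL)
      exact ⟨q, fun _ => hq⟩
    · exact ⟨0, fun h => absurd h hL⟩
  choose q hq using key
  have hn : (A.hyperplanes.card : K) ≠ 0 := Nat.cast_ne_zero.2 hA.card_ne_zero
  -- `θ` multiplies `Q` by the sum of the quotients `q L`, and Euler multiplies it by `|A|`; the
  -- average of the `q L` cancels the two.
  refine ⟨C (A.hyperplanes.card : K)⁻¹ * ∑ L ∈ A.hyperplanes, q L,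
    ⟨A.logDer.sub_mem hθ (A.logDer.smul_mem _ euler_mem_logDer), ?_⟩, ?_⟩
  · have h1 : θ A.definingPoly = A.definingPoly * ∑ L ∈ A.hyperplanes, q L :=
      derivation_prod fun L hL => (hq L hL).1
    have h2 : (A.hyperplanes.card : MvPolynomial (Fin ℓ) K) * C (A.hyperplanes.card : K)⁻¹ = 1 := by
      rw [← C_eq_coe_nat, ← C_mul, mul_inv_cancel₀ hn, C_1]
    simp only [Derivation.sub_apply, Derivation.smul_apply, smul_eq_mul, h1, euler_definingPoly]
    linear_combination (-A.definingPoly * ∑ L ∈ A.hyperplanes, q L) * h2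
  · refine isHomogeneousDer_iff.2 fun j => ?_
    simp only [Derivation.sub_apply, Derivation.smul_apply, smul_eq_mul, euler_X, mul_assoc,
      Finset.sum_mul]
    exact (he _ (isHomogeneous_X K j)).sub
      ((IsHomogeneous.sum _ _ _ fun L hL => (hq L hL).2 _ (isHomogeneous_X K j)).C_mul _)

end LogDer

/-! ### Comparing `D(A)` with `D(A')`. -/

section Deletion

variable {A : HyperplaneArrangement K ℓ} {H : Submodule K (Fin ℓ → K)}

theorem mem_deletion {L : Submodule K (Fin ℓ → K)} :
    L ∈ (A.deletion H).hyperplanes ↔ L ≠ H ∧ L ∈ A.hyperplanes := by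
  simp [deletion]

theorem definingPoly_eq_mul_deletion (hH : H ∈ A.hyperplanes) :
    A.definingPoly = toPoly (linearForm H) * (A.deletion H).definingPoly := by
  classical
  rw [definingPoly, definingPoly, deletion, ← Finset.mul_prod_erase _ _ hH]

theorem card_deletion_add_one (hH : H ∈ A.hyperplanes) :
    (A.deletion H).hyperplanes.card + 1 = A.hyperplanes.card := by
  classical
  rw [← Finset.card_erase_add_one hH, deletion]

theorem not_dvd_definingPoly_deletion (hH : H ∈ A.hyperplanes) :
    ¬ toPoly (linearForm H) ∣ (A.deletion H).definingPoly := by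
  rw [definingPoly, (prime_toPoly (linearForm_ne_zero (A.isCoatom' H hH))).dvd_finsetProd_iff]
  rintro ⟨L, hL, hd⟩
  rw [mem_deletion] at hL
  exact not_toPoly_linearForm_dvd (A.isCoatom' H hH) (A.isCoatom' L hL.2) hL.1.symm hd

theorem mem_logDer_iff_deletion (hH : H ∈ A.hyperplanes) {θ : Der K ℓ} : θ ∈ A.logDer ↔
    θ ∈ (A.deletion H).logDer ∧ toPoly (linearForm H) ∣ θ (toPoly (linearForm H)) := by
  simp only [mem_logDer, mem_deletion]
  refine ⟨fun h => ⟨fun L hL => h L hL.2, h H hH⟩, fun h L hL => ?_⟩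
  by_cases hLH : L = H
  · exact hLH ▸ h.2
  · exact h.1 L ⟨hLH, hL⟩

theorem smul_mem_logDer_iff (hH : H ∈ A.hyperplanes) {θ : Der K ℓ} :
    toPoly (linearForm H) • θ ∈ A.logDer ↔ θ ∈ (A.deletion H).logDer := by
  rw [mem_logDer_iff_deletion hH]
  constructor
  · refine fun h => mem_logDer.2 fun L hL => ?_
    have h1 := mem_logDer.1 h.1 L hL
    rw [mem_deletion] at hL
    refine ((prime_toPoly (linearForm_ne_zero (A.isCoatom' L hL.2))).dvd_or_dvd h1).resolve_left ?_
    exact not_toPoly_linearForm_dvd (A.isCoatom' L hL.2) (A.isCoatom' H hH) hL.1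
  · exact fun h => ⟨Submodule.smul_mem _ _ h, by simp⟩

end Deletion

/-! ### Low degrees of `D(A)`. -/

section Exponents

variable {A : HyperplaneArrangement K ℓ}

/-- Below the second exponent, the only logarithmic derivations are multiples of the Euler
derivation. -/
theorem exists_eq_smul_euler {θ : Fin ℓ → Der K ℓ} {d : Fin ℓ → ℕ}
    (hθ0 : ∀ j : Fin ℓ, (j : ℕ) = 0 → θ j = euler K ℓ)
    (hhom : ∀ j, IsHomogeneousDer (θ j) (d j))
    (hspan : Submodule.span (MvPolynomial (Fin ℓ) K) (Set.range θ) = A.logDer)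
    {e : ℕ} (hd : ∀ j : Fin ℓ, (j : ℕ) ≠ 0 → e < d j) {η : Der K ℓ} (hη : η ∈ A.logDer)
    (he : IsHomogeneousDer η e) : ∃ f : MvPolynomial (Fin ℓ) K, η = f • euler K ℓ := by
  rw [← hspan, Submodule.mem_span_range_iff_exists_fun] at hη
  obtain ⟨c, rfl⟩ := hη
  -- The coefficients `c i` need not be homogeneous, so the degree `e` part is extracted; generators
  -- of degree above `e` contribute nothing to it.
  have key : ∀ i : Fin ℓ, ∃ f : MvPolynomial (Fin ℓ) K, ∀ j : Fin ℓ,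
      homogeneousComponent e (c i * θ i (X j)) = f * X j := by
    intro i
    by_cases hi : (i : ℕ) = 0
    · simp only [hθ0 i hi, euler_X]
      rcases e with _ | k
      · exact ⟨0, fun j => by
          rw [homogeneousComponent_mul_eq_zero (isHomogeneous_X K j) one_pos, zero_mul]⟩
      · exact ⟨_, fun j => homogeneousComponent_add_mul (isHomogeneous_X K j) k⟩
    · exact ⟨0, fun j => by
        rw [homogeneousComponent_mul_eq_zero (isHomogeneousDer_iff.1 (hhom i) j) (hd i hi),
          zero_mul]⟩
  choose f hf using key
  refine ⟨∑ i, f i, derivation_ext fun j => ?_⟩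
  rw [← homogeneousComponent_eq_self (isHomogeneousDer_iff.1 he j)]
  simp [derivation_sum_apply, hf, euler_X, Finset.sum_mul]

end Exponents

/-! ### Saito's criterion. -/

section Saito

/-- Multiplying `N c` by the adjugate gives `det N • c`, and one entry of `c` is a unit. -/
theorem dvd_det_of_dvd_mulVec {n R : Type*} [Fintype n] [DecidableEq n] [CommRing R]
    {N : Matrix n n R} {c : n → R} {q : n} (hq : IsUnit (c q)) {a : R}
    (h : ∀ k, a ∣ N.mulVec c k) : a ∣ N.det := by
  have h1 : N.adjugate.mulVec (N.mulVec c) = N.det • c := by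
    rw [Matrix.mulVec_mulVec, Matrix.adjugate_mul, Matrix.smul_mulVec, Matrix.one_mulVec]
  have h2 : N.det * c q = ∑ k, N.adjugate q k * N.mulVec c k := by
    simpa [Matrix.mulVec, dotProduct] using (congrFun h1 q).symm
  exact hq.dvd_mul_right.1 (h2 ▸ Finset.dvd_sum fun k _ => (h k).mul_left _)

/-- The coefficient matrix of a family of derivations. -/
noncomputable def coeffMatrix (θ : Fin ℓ → Der K ℓ) : Matrix (Fin ℓ) (Fin ℓ) (MvPolynomial (Fin ℓ) K) :=
  Matrix.of fun i j => θ i (X j)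

theorem coeffMatrix_mulVec (θ : Fin ℓ → Der K ℓ) (b : Module.Dual K (Fin ℓ → K)) (i : Fin ℓ) :
    (coeffMatrix θ).mulVec (fun j => C (b (Pi.single j 1))) i = θ i (toPoly b) := by
  simp [der_toPoly, Matrix.mulVec, dotProduct, coeffMatrix, mul_comm]

variable {A : HyperplaneArrangement K ℓ}

theorem definingPoly_dvd_det {θ : Fin ℓ → Der K ℓ} (hθ : ∀ i, θ i ∈ A.logDer) :
    A.definingPoly ∣ (coeffMatrix θ).det := by
  refine Finset.prod_dvd_of_isRelPrime (fun L hL L' hL' hne =>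
    isRelPrime_linearForm (A.isCoatom' L hL) (A.isCoatom' L' hL') hne) fun L hL => ?_
  obtain ⟨p, hp⟩ := exists_apply_single_ne_zero (linearForm_ne_zero (A.isCoatom' L hL))
  refine dvd_det_of_dvd_mulVec (c := fun j => C (linearForm L (Pi.single j 1))) (q := p)
    ((isUnit_iff_ne_zero.2 hp).map C) fun k => ?_
  rw [coeffMatrix_mulVec]
  exact mem_logDer.1 (hθ k) L hL

theorem det_dvd_det {θ η : Fin ℓ → Der K ℓ}
    (hη : ∀ i, η i ∈ Submodule.span (MvPolynomial (Fin ℓ) K) (Set.range θ)) :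
    (coeffMatrix θ).det ∣ (coeffMatrix η).det := by
  simp only [Submodule.mem_span_range_iff_exists_fun] at hη
  choose c hc using hη
  have : coeffMatrix η = Matrix.of c * coeffMatrix θ := by
    ext1 i j
    simp [Matrix.mul_apply, coeffMatrix, ← hc, derivation_sum_apply]
  rw [this, Matrix.det_mul]
  exact Dvd.intro_left _ rfl

/-- A test family for bounding the determinant of generators: its determinant contains `α_H` only
once. -/
theorem exists_det_eq {H : Submodule K (Fin ℓ → K)} (hH : H ∈ A.hyperplanes) :
    ∃ η : Fin ℓ → Der K ℓ, (∀ i, η i ∈ A.logDer) ∧ ∃ k : ℕ,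
      (coeffMatrix η).det = A.definingPoly * (A.deletion H).definingPoly ^ k := by
  classical
  obtain ⟨p, hp⟩ := exists_apply_single_ne_zero (linearForm_ne_zero (A.isCoatom' H hH))
  set a := linearForm H with ha
  set q := (A.deletion H).definingPoly with hq
  -- For `j ≠ p` the field `∂_j - u_j ∂_p` kills `α_H`, so the factor `Q'` suffices; only `∂_p`
  -- needs all of `Q`.
  let w : Fin ℓ → MvPolynomial (Fin ℓ) K := fun j => if j = p then A.definingPoly else q
  let u : Fin ℓ → MvPolynomial (Fin ℓ) K := fun j =>
    if j = p then 0 else C (a (Pi.single j 1) / a (Pi.single p 1))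
  refine ⟨fun j => w j • (pderiv j - u j • pderiv p), fun j => ?_, (Finset.univ.erase p).card, ?_⟩
  · by_cases hj : j = p
    · simp only [w, if_pos hj]
      exact definingPoly_smul_mem A _
    · simp only [w, if_neg hj, mem_logDer_iff_deletion hH]
      refine ⟨definingPoly_smul_mem _ _, ?_⟩
      have hpd : ∀ i, pderiv i (toPoly a) = C (a (Pi.single i 1)) := fun i => by
        rw [der_toPoly]
        simp [pderiv_X, Pi.single_apply]
      rw [← ha, Derivation.smul_apply, Derivation.sub_apply, Derivation.smul_apply, hpd, hpd]
      simp only [u, if_neg hj, smul_eq_mul]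
      rw [← C_mul, div_mul_cancel₀ _ hp, sub_self, mul_zero]
      exact dvd_zero _
  -- The unscaled matrix is the identity plus a rank one matrix; since `u p = 0`, its determinant is
  -- 1.
  · have hM : coeffMatrix (fun j => w j • (pderiv j - u j • pderiv p)) = Matrix.diagonal w *
        (1 + Matrix.replicateCol Unit (-u) *
          Matrix.replicateRow Unit (Pi.single p (1 : MvPolynomial (Fin ℓ) K))) := by
      ext1 i j
      rw [Matrix.diagonal_mul]
      simp [coeffMatrix, pderiv_X, Matrix.mul_apply, Matrix.one_apply, Pi.single_apply,
        eq_comm (a := j), sub_eq_add_neg]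
      split_ifs <;> ring
    rw [hM, Matrix.det_mul, Matrix.det_diagonal, Matrix.det_one_add_replicateCol_mul_replicateRow]
    have hu : u p = 0 := by simp [u]
    simp only [single_dotProduct, Pi.neg_apply, hu, neg_zero, mul_zero, add_zero, mul_one]
    rw [← Finset.mul_prod_erase _ _ (Finset.mem_univ p)]
    congr 1
    · simp [w]
    · rw [← Finset.prod_const]
      exact Finset.prod_congr rfl fun j hj => by simp [w, Finset.ne_of_mem_erase hj]

/-- An irreducible factor of `g` would be associated to some `α_L` with `L ∈ A`, but the hypothesis
at `L` itself excludes `α_L`. -/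
theorem isUnit_of_dvd_definingPoly_deletion_pow (hA : A.hyperplanes.Nonempty)
    {g : MvPolynomial (Fin ℓ) K}
    (h : ∀ H ∈ A.hyperplanes, ∃ k : ℕ, g ∣ (A.deletion H).definingPoly ^ k) : IsUnit g := by
  by_contra hu
  obtain ⟨H, hH⟩ := hA
  have hg : g ≠ 0 := by
    rintro rfl
    obtain ⟨k, hk⟩ := h H hH
    exact pow_ne_zero k (definingPoly_ne_zero _) (zero_dvd_iff.1 hk)
  obtain ⟨π, hπ, hπg⟩ := WfDvdMonoid.exists_irreducible_factor hu hg
  obtain ⟨k, hk⟩ := h H hH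
  obtain ⟨L, hL, hd⟩ := (hπ.prime.dvd_finsetProd_iff _).1 (hπ.prime.dvd_of_dvd_pow (hπg.trans hk))
  have hLA := (mem_deletion.1 hL).2
  have hα := prime_toPoly (linearForm_ne_zero (A.isCoatom' L hLA))
  obtain ⟨k', hk'⟩ := h L hLA
  exact not_dvd_definingPoly_deletion hLA (hα.dvd_of_dvd_pow
    (((hπ.associated_of_dvd hα.irreducible hd).symm.dvd.trans hπg).trans hk'))

/-- Saito's criterion: the coefficient determinant of `ℓ` generators of `D(A)` is a nonzero
constant multiple of the defining polynomial. -/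
theorem exists_det_eq_C_mul (hA : A.hyperplanes.Nonempty) {θ : Fin ℓ → Der K ℓ}
    (hspan : Submodule.span (MvPolynomial (Fin ℓ) K) (Set.range θ) = A.logDer) :
    ∃ c : K, c ≠ 0 ∧ (coeffMatrix θ).det = C c * A.definingPoly := by
  obtain ⟨g, hg⟩ := definingPoly_dvd_det (A := A) (θ := θ) fun i =>
    hspan ▸ Submodule.subset_span ⟨i, rfl⟩
  have hu : IsUnit g := isUnit_of_dvd_definingPoly_deletion_pow hA fun H hH => by
    obtain ⟨η, hη, k, hk⟩ := exists_det_eq hH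
    have := det_dvd_det (θ := θ) (η := η) fun i => hspan ▸ hη i
    rw [hg, hk] at this
    exact ⟨k, (mul_dvd_mul_iff_left A.definingPoly_ne_zero).1 this⟩
  obtain ⟨c, hc, rfl⟩ := isUnit_iff_eq_C_of_isReduced.1 hu
  exact ⟨c, hc.ne_zero, by rw [hg, mul_comm]⟩

end Saito

/-! ### The restriction `A^H` and degrees in `D(A')` outside `D(A)`. -/

section Restriction

variable (A : HyperplaneArrangement K ℓ) (H : Submodule K (Fin ℓ → K)) (p : Fin ℓ)

/-- For `X` in the restriction to `H`, a linear form whose restriction to `H` defines `X`. -/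
noncomputable def restrictionForm (X : Submodule K (Fin ℓ → K)) : Module.Dual K (Fin ℓ → K) :=
  reduceForm (linearForm H) p (linearForm
    (Classical.epsilon fun L => L ∈ (A.deletion H).hyperplanes ∧ H ⊓ L = X))

/-- The defining polynomial of the restriction, in the variables other than `x_p`. -/
noncomputable def restrictionPoly : MvPolynomial (Fin ℓ) K :=
  ∏ X ∈ A.restriction H, toPoly (restrictionForm A H p X)

variable {A H p}

theorem mem_restriction {X : Submodule K (Fin ℓ → K)} :
    X ∈ A.restriction H ↔ ∃ L ∈ (A.deletion H).hyperplanes, H ⊓ L = X := by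
  classical
  simp [restriction, deletion]

theorem restrictionForm_spec {X : Submodule K (Fin ℓ → K)} (hX : X ∈ A.restriction H) :
    ∃ L ∈ (A.deletion H).hyperplanes, H ⊓ L = X ∧
      restrictionForm A H p X = reduceForm (linearForm H) p (linearForm L) :=
  let h := Classical.epsilon_spec (mem_restriction.1 hX)
  ⟨_, h.1, h.2, rfl⟩

theorem reduceForm_linearForm_ne_zero (hH : H ∈ A.hyperplanes) {L : Submodule K (Fin ℓ → K)}
    (hL : L ∈ (A.deletion H).hyperplanes) : reduceForm (linearForm H) p (linearForm L) ≠ 0 :=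
  have h := mem_deletion.1 hL
  reduceForm_ne_zero (linearForm_ne_smul (A.isCoatom' H hH) (A.isCoatom' L h.2) h.1.symm)

theorem restrictionForm_ne_zero (hH : H ∈ A.hyperplanes) {X : Submodule K (Fin ℓ → K)}
    (hX : X ∈ A.restriction H) : restrictionForm A H p X ≠ 0 := by
  obtain ⟨L, hL, -, h⟩ := restrictionForm_spec (p := p) hX
  exact h ▸ reduceForm_linearForm_ne_zero hH hL

theorem isRelPrime_reduceForm (hH : H ∈ A.hyperplanes) {L L' : Submodule K (Fin ℓ → K)}
    (hL : L ∈ (A.deletion H).hyperplanes) (hL' : L' ∈ (A.deletion H).hyperplanes)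
    (hne : H ⊓ L ≠ H ⊓ L') :
    IsRelPrime (toPoly (reduceForm (linearForm H) p (linearForm L)))
      (toPoly (reduceForm (linearForm H) p (linearForm L'))) := by
  refine isRelPrime_toPoly (reduceForm_linearForm_ne_zero hH hL) fun c hc => hne ?_
  have hc0 : c ≠ 0 := by
    rintro rfl
    exact reduceForm_linearForm_ne_zero hH hL' (by simpa using hc)
  have h := ker_inf_ker_reduceForm (linearForm H) p (linearForm L')
  rwa [hc, LinearMap.ker_smul _ _ hc0, ker_inf_ker_reduceForm,
    ker_linearForm (A.isCoatom' H hH), ker_linearForm ((A.deletion H).isCoatom' L hL),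
    ker_linearForm ((A.deletion H).isCoatom' L' hL')] at h

theorem isRelPrime_restrictionForm (hH : H ∈ A.hyperplanes) {X Y : Submodule K (Fin ℓ → K)}
    (hX : X ∈ A.restriction H) (hY : Y ∈ A.restriction H) (hne : X ≠ Y) :
    IsRelPrime (toPoly (restrictionForm A H p X)) (toPoly (restrictionForm A H p Y)) := by
  obtain ⟨L, hL, rfl, h⟩ := restrictionForm_spec (p := p) hX
  obtain ⟨L', hL', rfl, h'⟩ := restrictionForm_spec (p := p) hY
  rw [h, h']
  exact isRelPrime_reduceForm hH hL hL' hne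

theorem restrictionPoly_isHomogeneous :
    (restrictionPoly A H p).IsHomogeneous (A.restriction H).card := by
  simpa [restrictionPoly] using IsHomogeneous.prod (A.restriction H)
    (fun X => toPoly (restrictionForm A H p X)) (fun _ => 1) fun _ _ => toPoly_isHomogeneous _

theorem restrictionPoly_ne_zero (hH : H ∈ A.hyperplanes) : restrictionPoly A H p ≠ 0 :=
  Finset.prod_ne_zero_iff.2 fun _ hX => toPoly_ne_zero (restrictionForm_ne_zero hH hX)

theorem not_dvd_restrictionPoly (hH : H ∈ A.hyperplanes)
    (hp : linearForm H (Pi.single p 1) ≠ 0) :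
    ¬ toPoly (linearForm H) ∣ restrictionPoly A H p := by
  have ha := linearForm_ne_zero (A.isCoatom' H hH)
  rw [restrictionPoly, (prime_toPoly ha).dvd_finsetProd_iff]
  rintro ⟨X, hX, hd⟩
  obtain ⟨c, hc⟩ := toPoly_dvd_toPoly ha hd
  obtain ⟨L, hL, -, h⟩ := restrictionForm_spec (p := p) hX
  have h1 := reduceForm_apply_single hp (linearForm L)
  rw [← h, hc, LinearMap.smul_apply, smul_eq_mul, mul_eq_zero] at h1
  exact restrictionForm_ne_zero hH hX (by rw [hc, h1.resolve_right hp, zero_smul])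

theorem reduceForm_dvd_reduce {θ : Der K ℓ} (hp : linearForm H (Pi.single p 1) ≠ 0)
    (hH : H ∈ A.hyperplanes) (hθ : θ ∈ A.logDer) {L : Submodule K (Fin ℓ → K)}
    (hL : L ∈ A.hyperplanes) :
    toPoly (reduceForm (linearForm H) p (linearForm L)) ∣ reduce (linearForm H) p
      (θ (toPoly (reduceForm (linearForm H) p (linearForm L)))) := by
  have h1 : reduce (linearForm H) p (θ (toPoly (linearForm H))) = 0 :=
    (dvd_iff_reduce_eq_zero hp).1 (mem_logDer.1 hθ H hH)
  have h2 : reduce (linearForm H) p (θ (toPoly (reduceForm (linearForm H) p (linearForm L)))) =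
      reduce (linearForm H) p (θ (toPoly (linearForm L))) := by
    rw [toPoly_reduceForm, map_sub, Derivation.leibniz]
    simp [h1]
  rw [h2, ← reduce_toPoly]
  exact map_dvd _ (mem_logDer.1 hθ L hL)

/-- The maximal minors of the coefficient matrix restricted to `H` are divisible by the defining
polynomial of the restriction. -/
theorem restrictionPoly_dvd_reduce_adjugate (hp : linearForm H (Pi.single p 1) ≠ 0)
    (hH : H ∈ A.hyperplanes) {θ : Fin ℓ → Der K ℓ} (hθ : ∀ i, θ i ∈ A.logDer) (i : Fin ℓ) :
    restrictionPoly A H p ∣ reduce (linearForm H) p ((coeffMatrix θ).adjugate p i) := by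
  refine Finset.prod_dvd_of_isRelPrime (fun X hX Y hY hne =>
    isRelPrime_restrictionForm hH hX hY hne) fun X hX => ?_
  obtain ⟨q, hq⟩ := exists_apply_single_ne_zero (restrictionForm_ne_zero (p := p) hH hX)
  obtain ⟨L, hL, -, h⟩ := restrictionForm_spec (p := p) hX
  rw [h] at hq ⊢
  set b := reduceForm (linearForm H) p (linearForm L) with hb
  rw [Matrix.adjugate_apply, AlgHom.map_det]
  refine dvd_det_of_dvd_mulVec (c := fun j => C (b (Pi.single j 1))) (q := q)
    ((isUnit_iff_ne_zero.2 hq).map C) fun k => ?_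
  -- The adjugate entry is the determinant with row `i` replaced by the `p`-th unit vector; that row
  -- pairs to zero with `b`, which does not involve `x_p`.
  by_cases hk : k = i
  · subst hk
    have : b (Pi.single p 1) = 0 := reduceForm_apply_single hp _
    simp [Matrix.mulVec, dotProduct, Pi.single_apply, apply_ite, this]
  · convert reduceForm_dvd_reduce hp hH (hθ k) (mem_deletion.1 hL).2 using 1
    rw [← hb, ← coeffMatrix_mulVec]
    simp [Matrix.mulVec, dotProduct, hk]

/-- If `D(A)` is generated by `ℓ` derivations, then the deletion has a logarithmic derivation
of degree `|A'| - |A^H|` that is not logarithmic along `H`. -/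
theorem exists_deletion_logDer (hH : H ∈ A.hyperplanes) {θ : Fin ℓ → Der K ℓ}
    (hspan : Submodule.span (MvPolynomial (Fin ℓ) K) (Set.range θ) = A.logDer) {e : ℕ}
    (he : e + (A.restriction H).card = (A.deletion H).hyperplanes.card) :
    ∃ φ ∈ (A.deletion H).logDer, IsHomogeneousDer φ e ∧
      ¬ toPoly (linearForm H) ∣ φ (toPoly (linearForm H)) := by
  have hθ : ∀ i, θ i ∈ A.logDer := fun i => hspan ▸ Submodule.subset_span ⟨i, rfl⟩
  have ha := linearForm_ne_zero (A.isCoatom' H hH)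
  obtain ⟨p, hp⟩ := exists_apply_single_ne_zero ha
  obtain ⟨c, hc, hdet⟩ := exists_det_eq_C_mul ⟨H, hH⟩ hspan
  have hα := prime_toPoly ha
  have hα0 := hα.ne_zero
  set a := linearForm H with ha_def
  set α := toPoly a with hα_def
  set R := restrictionPoly A H p with hR
  set Q' := (A.deletion H).definingPoly with hQ'
  choose v hv using restrictionPoly_dvd_reduce_adjugate hp hH hθ
  choose u hu using fun i => dvd_sub_reduce a p ((coeffMatrix θ).adjugate p i)
  have hadj : ∀ j, ∑ i, (coeffMatrix θ).adjugate p i * θ i (X j) =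
      C c * (α * Q') * pderiv p (X j) := fun j => by
    have := congrFun (congrFun (Matrix.adjugate_mul (coeffMatrix θ)) p) j
    rw [hdet, definingPoly_eq_mul_deletion hH] at this
    simpa [Matrix.mul_apply, coeffMatrix, Matrix.one_apply, pderiv_X, Pi.single_apply,
      eq_comm] using this
  have hsplit : ∀ j, R * ∑ i, v i * θ i (X j) =
      α * (C c * Q' * pderiv p (X j) - ∑ i, u i * θ i (X j)) := fun j => by
    have h1 : ∀ i, (coeffMatrix θ).adjugate p i = α * u i + R * v i := fun i => by
      rw [← hu, ← hv]; ring
    have h2 := hadj j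
    simp only [h1, add_mul, Finset.sum_add_distrib, mul_assoc, ← Finset.mul_sum] at h2
    linear_combination h2
  have hdvd : ∀ j, α ∣ ∑ i, v i * θ i (X j) := fun j =>
    (hα.dvd_or_dvd (Dvd.intro _ (hsplit j).symm)).resolve_left (not_dvd_restrictionPoly hH hp)
  choose w hw using hdvd
  let φ : Der K ℓ := mkDerivation K w
  have hαφ : α • φ = ∑ i, v i • θ i := derivation_ext fun j => by
    simp [φ, derivation_sum_apply, hw, mkDerivation_X]
  have hφ : φ ∈ (A.deletion H).logDer := by
    rw [← smul_mem_logDer_iff hH, ← ha_def, ← hα_def, hαφ]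
    exact Submodule.sum_mem _ fun i _ => Submodule.smul_mem _ _ (hθ i)
  have hRφ : R • φ = (C c * Q') • pderiv p - ∑ i, u i • θ i := derivation_ext fun j => by
    refine mul_left_cancel₀ hα0 ?_
    have h1 := hsplit j
    rw [hw] at h1
    simp only [Derivation.smul_apply, Derivation.sub_apply, derivation_sum_apply, φ,
      mkDerivation_X, smul_eq_mul]
    linear_combination h1
  refine ⟨homogeneousPart φ e, homogeneousPart_mem_logDer hφ e,
    isHomogeneousDer_homogeneousPart φ e, fun hd => ?_⟩
  rw [homogeneousPart_toPoly] at hd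
  have hpd : pderiv p α = C (a (Pi.single p 1)) := by
    rw [der_toPoly]
    simp [pderiv_X, Pi.single_apply]
  -- Applied to `α`, the formula for `R • φ` says that `R φ(α)` agrees modulo `α` with a nonzero
  -- constant times `Q'`. Comparing in degree `|A'|` shows that the degree `e` part of `φ(α)` is not
  -- divisible by `α`.
  have h1 : C c * Q' * C (a (Pi.single p 1)) - φ α * R = ∑ i, u i * θ i α := by
    have := congrArg (fun D : Der K ℓ => D α) hRφ
    simp only [Derivation.smul_apply, Derivation.sub_apply, derivation_sum_apply, smul_eq_mul,
      hpd] at this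
    linear_combination -this
  have h2 : α ∣ C c * Q' * C (a (Pi.single p 1)) - φ α * R :=
    h1 ▸ Finset.dvd_sum fun i _ => (mem_logDer.1 (hθ i) H hH).mul_left _
  have h3 := dvd_homogeneousComponent (toPoly_isHomogeneous a) h2 (e + (A.restriction H).card)
  rw [map_sub, homogeneousComponent_add_mul restrictionPoly_isHomogeneous] at h3
  have hhom : (C c * Q' * C (a (Pi.single p 1))).IsHomogeneous (e + (A.restriction H).card) := by
    rw [mul_comm, he]
    exact ((definingPoly_isHomogeneous _).C_mul c).C_mul _
  rw [homogeneousComponent_eq_self hhom, dvd_sub_left (hd.mul_right R)] at h3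
  have hC : ∀ x : K, x ≠ 0 → ¬ α ∣ C x := fun x hx h =>
    hα.not_isUnit (isUnit_of_dvd_unit h ((isUnit_iff_ne_zero.2 hx).map C))
  rcases hα.dvd_or_dvd h3 with h4 | h4
  · rcases hα.dvd_or_dvd h4 with h5 | h5
    · exact hC c hc h5
    · exact not_dvd_definingPoly_deletion hH h5
  · exact hC _ hp h4

/-- Since `L` and `L₀` meet `H` in the same subspace, `α_L` is a combination of `α_{L₀}` and `α_H`.
Up to a constant the expression is unchanged on replacing `L₀` by `L`, where divisibility is clear.
-/
theorem linearForm_dvd_sub (hH : H ∈ A.hyperplanes) {θ : Der K ℓ}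
    (hθ : θ ∈ (A.deletion H).logDer) {L L₀ : Submodule K (Fin ℓ → K)}
    (hL : L ∈ (A.deletion H).hyperplanes) (hL₀ : L₀ ∈ (A.deletion H).hyperplanes)
    (h : H ⊓ L₀ = H ⊓ L) :
    toPoly (linearForm L) ∣ toPoly (linearForm L₀) * θ (toPoly (linearForm H)) -
      toPoly (linearForm H) * θ (toPoly (linearForm L₀)) := by
  obtain ⟨p, hp⟩ := exists_apply_single_ne_zero (linearForm_ne_zero (A.isCoatom' H hH))
  obtain ⟨c, hc⟩ := exists_reduceForm_eq_smul (b := linearForm L₀) (b' := linearForm L) hp (by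
    rw [ker_linearForm (A.isCoatom' H hH), ker_linearForm ((A.deletion H).isCoatom' L hL),
      ker_linearForm ((A.deletion H).isCoatom' L₀ hL₀), h])
  have hc0 : c ≠ 0 := by
    rintro rfl
    exact reduceForm_linearForm_ne_zero hH hL (by simpa using hc)
  obtain ⟨k, hk⟩ : ∃ k : K, toPoly (linearForm L) =
      C c * toPoly (linearForm L₀) + C k * toPoly (linearForm H) := by
    have h1 := congrArg toPoly hc
    rw [toPoly_smul, toPoly_reduceForm, toPoly_reduceForm] at h1
    refine ⟨linearForm L (Pi.single p 1) / linearForm H (Pi.single p 1) -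
      c * (linearForm L₀ (Pi.single p 1) / linearForm H (Pi.single p 1)), ?_⟩
    rw [C_sub, C_mul]
    linear_combination h1
  have hθL : θ (toPoly (linearForm L)) =
      C c * θ (toPoly (linearForm L₀)) + C k * θ (toPoly (linearForm H)) := by
    rw [hk]; simp
  have hCu : IsUnit (C c : MvPolynomial (Fin ℓ) K) := (isUnit_iff_ne_zero.2 hc0).map C
  have h2 : C c * (toPoly (linearForm L₀) * θ (toPoly (linearForm H)) -
      toPoly (linearForm H) * θ (toPoly (linearForm L₀))) =
      toPoly (linearForm L) * θ (toPoly (linearForm H)) -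
      toPoly (linearForm H) * θ (toPoly (linearForm L)) := by
    rw [hθL]
    linear_combination (-θ (toPoly (linearForm H))) * hk
  refine hCu.dvd_mul_left.1 ?_
  rw [h2]
  exact dvd_sub (dvd_mul_right _ _) ((mem_logDer.1 hθ L hL).mul_left _)

/-- Group the hyperplanes of `A'` by their trace `X` on `H`. Modulo `α_H`, the product over one
group divides a single form for `X` times `θ(α_H)`; different groups are coprime. -/
theorem reduce_definingPoly_dvd (hH : H ∈ A.hyperplanes)
    (hp : linearForm H (Pi.single p 1) ≠ 0) {θ : Der K ℓ} (hθ : θ ∈ (A.deletion H).logDer) :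
    reduce (linearForm H) p (A.deletion H).definingPoly ∣
      restrictionPoly A H p * reduce (linearForm H) p (θ (toPoly (linearForm H))) := by
  classical
  rw [definingPoly, map_prod, ← Finset.prod_fiberwise_of_maps_to (g := fun L => H ⊓ L)
    (t := A.restriction H) fun L hL => mem_restriction.2 ⟨L, hL, rfl⟩]
  refine Finset.prod_dvd_of_isRelPrime (fun X _ Y _ hne => ?_) fun X hX => ?_
  · refine IsRelPrime.prod_left fun L hL => IsRelPrime.prod_right fun L' hL' => ?_
    rw [Finset.mem_filter] at hL hL'
    rw [reduce_toPoly, reduce_toPoly]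
    exact isRelPrime_reduceForm hH hL.1 hL'.1 (by rwa [hL.2, hL'.2])
  · obtain ⟨L₀, hL₀, rfl, h₀⟩ := restrictionForm_spec (p := p) hX
    have h1 : ∏ L ∈ (A.deletion H).hyperplanes with H ⊓ L = H ⊓ L₀, toPoly (linearForm L) ∣
        toPoly (linearForm L₀) * θ (toPoly (linearForm H)) -
          toPoly (linearForm H) * θ (toPoly (linearForm L₀)) := by
      refine Finset.prod_dvd_of_isRelPrime (fun L hL L' hL' hne => ?_) fun L hL => ?_
      · exact isRelPrime_linearForm ((A.deletion H).isCoatom' L (Finset.mem_filter.1 hL).1)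
          ((A.deletion H).isCoatom' L' (Finset.mem_filter.1 hL').1) hne
      · rw [Finset.mem_filter] at hL
        exact linearForm_dvd_sub hH hθ hL.1 hL₀ hL.2.symm
    have h2 := map_dvd (reduce (linearForm H) p) h1
    rw [map_prod, map_sub, map_mul, map_mul, reduce_self hp, zero_mul, sub_zero, reduce_toPoly _ _
      (linearForm L₀), ← h₀] at h2
    have h3 : toPoly (restrictionForm A H p (H ⊓ L₀)) ∣ restrictionPoly A H p :=
      Finset.dvd_prod_of_mem (fun X => toPoly (restrictionForm A H p X)) hX
    exact h2.trans (mul_dvd_mul_right h3 _)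

/-- A homogeneous derivation that is logarithmic for the deletion but not along `H` has degree
at least `|A'| - |A^H|`. -/
theorem card_deletion_le_add (hH : H ∈ A.hyperplanes) {θ : Der K ℓ}
    (hθ : θ ∈ (A.deletion H).logDer) {r : ℕ} (hr : IsHomogeneousDer θ r)
    (hnd : ¬ toPoly (linearForm H) ∣ θ (toPoly (linearForm H))) :
    (A.deletion H).hyperplanes.card ≤ (A.restriction H).card + r := by
  obtain ⟨p, hp⟩ := exists_apply_single_ne_zero (linearForm_ne_zero (A.isCoatom' H hH))
  have hne := mul_ne_zero (restrictionPoly_ne_zero (p := p) hH)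
    (mt (dvd_iff_reduce_eq_zero hp).2 hnd)
  have hQ : reduce (linearForm H) p (A.deletion H).definingPoly ≠ 0 :=
    mt (dvd_iff_reduce_eq_zero hp).2 (not_dvd_definingPoly_deletion hH)
  obtain ⟨g, hg⟩ := reduce_definingPoly_dvd hH hp hθ
  have hdeg := (restrictionPoly_isHomogeneous.mul (reduce_isHomogeneous (linearForm H) p
    (hr _ (toPoly_isHomogeneous (linearForm H))))).totalDegree hne
  rw [hg] at hne
  rw [← hdeg, hg, totalDegree_mul_of_isDomain hQ (right_ne_zero_of_mul hne),
    (reduce_isHomogeneous (linearForm H) p (definingPoly_isHomogeneous _)).totalDegree hQ]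
  exact Nat.le_add_right _ _

end Restriction

/-! ### Ingredients of the final degree comparison. -/

section Main

variable {A : HyperplaneArrangement K ℓ}
  {H : Submodule K (Fin ℓ → K)}

/-- If `H` were the only hyperplane, essentiality would force `H = 0`, making its linear form
injective on a space of dimension at least 2. -/
theorem deletion_nonempty (hℓ : 2 ≤ ℓ) (hess : A.IsEssential) (hH : H ∈ A.hyperplanes) :
    (A.deletion H).hyperplanes.Nonempty := by
  by_contra hne
  rw [Finset.not_nonempty_iff_eq_empty] at hne
  have hAH : ∀ L ∈ A.hyperplanes, L = H := fun L hL => by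
    by_contra hLH
    have := mem_deletion.2 ⟨hLH, hL⟩
    simp [hne] at this
  have hbot : H = ⊥ := by
    rw [← le_bot_iff, ← hess]
    exact le_iInf₂ fun L hL => (hAH L hL).ge
  have hker := ker_linearForm (A.isCoatom' H hH)
  rw [hbot, LinearMap.ker_eq_bot] at hker
  have := LinearMap.finrank_le_finrank_of_injective hker
  simp at this
  omega

theorem card_restriction_le : (A.restriction H).card ≤ (A.deletion H).hyperplanes.card := by
  classical
  unfold restriction deletion
  exact Finset.card_image_le

theorem smul_linearForm_isHomogeneousDer {η : Der K ℓ} {r : ℕ} (hr : IsHomogeneousDer η r)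
    (a : Module.Dual K (Fin ℓ → K)) : IsHomogeneousDer (toPoly a • η) (r + 1) := fun g hg => by
  rw [add_comm]
  exact (toPoly_isHomogeneous a).mul (hr g hg)

variable [CharZero K]

theorem not_dvd_of_mem_logDerZero_deletion (hA : (A.deletion H).hyperplanes.Nonempty)
    (hH : H ∈ A.hyperplanes) {r : ℕ}
    (hlow : ∀ η ∈ A.logDer, IsHomogeneousDer η r →
      ∃ f : MvPolynomial (Fin ℓ) K, η = f • euler K ℓ)
    {η : Der K ℓ} (hη : η ∈ (A.deletion H).logDerZero) (hη0 : η ≠ 0)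
    (hr : IsHomogeneousDer η r) :
    ¬ toPoly (linearForm H) ∣ η (toPoly (linearForm H)) := by
  intro hd
  obtain ⟨f, rfl⟩ := hlow η ((mem_logDer_iff_deletion hH).2 ⟨hη.1, hd⟩) hr
  have hf := eq_zero_of_smul_euler_definingPoly (f := f) hA (by simpa using hη.2)
  exact hη0 (by rw [hf, zero_smul])

theorem linearForm_smul_ne_smul_euler (hA : (A.deletion H).hyperplanes.Nonempty)
    (hH : H ∈ A.hyperplanes) {η : Der K ℓ} (hη : η ∈ (A.deletion H).logDerZero) (hη0 : η ≠ 0)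
    {f : MvPolynomial (Fin ℓ) K} : toPoly (linearForm H) • η ≠ f • euler K ℓ := by
  intro h
  have h1 : f * euler K ℓ (A.deletion H).definingPoly = 0 := by
    have := congrArg (fun D : Der K ℓ => D (A.deletion H).definingPoly) h
    simpa [hη.2] using this.symm
  rw [eq_zero_of_smul_euler_definingPoly hA h1, zero_smul] at h
  refine hη0 (derivation_ext fun j => ?_)
  have hj : toPoly (linearForm H) * η (X j) = 0 := congrArg (fun D : Der K ℓ => D (X j)) h
  exact (mul_eq_zero.1 hj).resolve_left (toPoly_ne_zero (linearForm_ne_zero (A.isCoatom' H hH)))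

end Main

end HyperplaneArrangement

open HyperplaneArrangement

theorem theorem2p12 {K : Type*} [Field K] [CharZero K] {ℓ : ℕ} (hℓ : 2 ≤ ℓ)
    (A : HyperplaneArrangement K ℓ) (hess : A.IsEssential)
    (hfree : A.IsFree) (d : Fin ℓ → ℕ) (hexp : A.HasExponents d) (hd : Monotone d)
    (H : Submodule K (Fin ℓ → K)) (hH : H ∈ A.hyperplanes) :
    (((A.deletion H).mdr : ℤ) = (d ⟨1, hℓ⟩ : ℤ) - 1 ↔
      (A.hyperplanes.card : ℤ) - ((A.restriction H).card : ℤ) = (d ⟨1, hℓ⟩ : ℤ)) ∧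
    ((A.hyperplanes.card : ℤ) - ((A.restriction H).card : ℤ) ≠ (d ⟨1, hℓ⟩ : ℤ) →
      (A.deletion H).mdr = d ⟨1, hℓ⟩) := by

  obtain ⟨θ, hθ0, hhom, hspan, hmin⟩ := hexp
  have hA := deletion_nonempty hℓ hess hH
  have hlow : ∀ e < d ⟨1, hℓ⟩, ∀ η ∈ A.logDer, IsHomogeneousDer η e →
      ∃ f : MvPolynomial (Fin ℓ) K, η = f • euler K ℓ := fun e he η hη hηe =>
    exists_eq_smul_euler hθ0 hhom hspan
      (fun j hj => he.trans_le (hd (Fin.le_def.2 (Nat.one_le_iff_ne_zero.2 hj)))) hη hηe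
  have hlower : ∀ η ∈ (A.deletion H).logDerZero, η ≠ 0 → ∀ r, IsHomogeneousDer η r →
      d ⟨1, hℓ⟩ ≤ r + 1 := fun η hη hη0 r hr => by
    by_contra! hlt
    obtain ⟨f, hf⟩ := hlow _ hlt _ ((smul_mem_logDer_iff hH).2 hη.1)
      (smul_linearForm_isHomogeneousDer hr _)
    exact linearForm_smul_ne_smul_euler hA hH hη hη0 hf
  obtain ⟨⟨η, hη, hη0, hηr⟩, hleast⟩ := isLeast_mdr hℓ (A.deletion H)
  have hη_low := hlower η hη hη0 _ hηr
  have hupper : (A.deletion H).mdr ≤ d ⟨1, hℓ⟩ := by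
    have hθ1 : θ ⟨1, hℓ⟩ ∈ (A.deletion H).logDer :=
      ((mem_logDer_iff_deletion hH).1 (hspan ▸ Submodule.subset_span ⟨_, rfl⟩)).1
    obtain ⟨f, hf, hfhom⟩ := exists_sub_smul_euler_mem_logDerZero hA hθ1 (hhom _)
    -- If the corrected `θ_2` vanished, `θ_2` would be a multiple of `θ_1`, contradicting minimality
    -- of the generators.
    refine hleast ⟨_, hf, fun h0 => hmin ⟨1, hℓ⟩ ?_, hfhom⟩
    rw [sub_eq_zero.1 h0, ← hθ0 ⟨0, by omega⟩ rfl]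
    exact Submodule.smul_mem _ _ (Submodule.subset_span ⟨_, by simp, rfl⟩)
  obtain ⟨e, he⟩ := Nat.exists_eq_add_of_le' (card_restriction_le (A := A) (H := H))
  obtain ⟨φ, hφ, hφe, hφnd⟩ := exists_deletion_logDer hH hspan he.symm
  obtain ⟨f, hψ, hψe⟩ := exists_sub_smul_euler_mem_logDerZero hA hφ hφe
  have hψ0 : φ - f • euler K ℓ ≠ 0 := fun h0 => hφnd (by
    rw [sub_eq_zero.1 h0, Derivation.smul_apply, euler_toPoly]
    exact dvd_mul_left _ _)
  have hψ_low := hlower _ hψ hψ0 e hψe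
  have hmdr_le := hleast ⟨_, hψ, hψ0, hψe⟩
  have hstep : (A.deletion H).mdr < d ⟨1, hℓ⟩ → e ≤ (A.deletion H).mdr := fun hlt => by
    have := card_deletion_le_add hH hη.1 hηr
      (not_dvd_of_mem_logDerZero_deletion hA hH (hlow _ hlt) hη hη0 hηr)
    omega
  have hcard := card_deletion_add_one hH
  -- With `r = r(A')`, the facts `d_2 - 1 ≤ r ≤ d_2`, `d_2 - 1 ≤ e`, `r ≤ e`, `r < d_2 → e ≤ r` and
  -- `|A| - |A^H| = e + 1` decide both claims.
  omega
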